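/- **Setting (LF with refinements, LFR, in canonical-forms style).** The syntax, up to renaming of bound variables, is $$\begin{array}{ll} R ::= c \mid x \mid R\,N,\quad N ::= R \mid \lambda x.N & \text{(atomic, normal terms)}\\ P ::= a \mid P\,N,\quad A,B ::= P \mid \Pi x{:}A.B,\quad K ::= \mathsf{type} \mid \Pi x{:}A.K & \text{(types, kinds)}\\ Q ::= s \mid Q\,N,\quad S,T ::= Q \mid \Pi x{::}S{\sqsubset}A.\,T \mid \top \mid S_1\wedge S_2 & \text{(sorts)}\\ L ::= \mathsf{sort} \mid \Pi x{::}S{\sqsubset}A.\,L \mid \top \mid L_1\wedge L_2 & \text{(classes)}\\ \Gamma ::= \cdot \mid \Gamma, x{::}S{\sqsubset}A,\qquad \Sigma ::= \cdot \mid \Sigma, D & \text{(contexts, signatures)}\\ D ::= a{:}K \mid c{:}A \mid s{\sqsubset}a{::}L \mid s_1\le s_2 \mid c{::}S & \text{(declarations)}\\ \alpha,\beta ::= a \mid \alpha\to\beta & \text{(simple types)} \end{array}$$ The erasure $A^-$ to simple types is $a^-=a$, $(P\,N)^-=P^-$, $(\Pi x{:}A.B)^-=A^-\to B^-$. The $\eta$-expansion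 is $\eta_a(R)=R$, $\eta_{\alpha\to\beta}(R)=\lambda x.\,\eta_\beta(R\,\eta_\alpha(x))$ with $x$ fresh, and $\eta_A(R):=\eta_{A^-}(R)$. $|\Gamma|$ and $|\Sigma|$ are the LF context and LF signature obtained by keeping only the declarations $x{:}A$ of $\Gamma$, and only the declarations $a{:}K$ and $c{:}A$ of $\Sigma$. *Hereditary substitution* $[N_0/x_0]_{\alpha_0}$ (written $[N_0/x_0]_A$ when $\alpha_0=A^-$) is a partial operation. On an atomic term whose head is not $x_0$ it acts compositionally and yields an atomic term. On an atomic term with head $x_0$ it yields a normal term with a simple type: $x_0\mapsto(N_0,\alpha_0)$; and if $R_1\mapsto(\lambda x.N_1,\alpha_2\to\alpha_1)$, $[N_0/x_0]_{\alpha_0}N_2=N_2'$ and $[N_2'/x]_{\alpha_2}N_1=N_1'$, then $R_1\,N_2\mapsto(N_1',\alpha_1)$. On a normal term $R$ with head $x_0$ it is defined with value $R'$ iff $R\mapsto(R',a)$ with $R'$ atomic and $a$ a base type. On everything else it is compositional and capture-avoiding. *LF judgments* are the usual ones of canonical LF over $|\Sigma|$: $R\Rightarrow A$ and $N\Leftarrow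 A$ for terms, $P\Rightarrow K$, well-formedness of types, kinds and contexts; application uses hereditary substitution, and an atomic term is checked only at an atomic type, by equality of types. *LFR judgments* over $\Sigma$ are generated by: - $\Gamma\vdash R\Rightarrow S$: $c\Rightarrow S$ if $c{::}S\in\Sigma$; $x\Rightarrow S$ if $x{::}S{\sqsubset}A\in\Gamma$; if $R\Rightarrow\Pi x{::}S{\sqsubset}A.T$, $N\Leftarrow S$ and $[N/x]_A T=T'$ then $R\,N\Rightarrow T'$; if $R\Rightarrow S_1\wedge S_2$ then $R\Rightarrow S_1$ and $R\Rightarrow S_2$. - $\Gamma\vdash N\Leftarrow S$: $R\Leftarrow Q$ if $R\Rightarrow Q'$ and $Q'\le Q$; $\lambda x.N\Leftarrow\Pi x{::}S{\sqsubset}A.T$ if $\Gamma,x{::}S{\sqsubset}A\vdash N\Leftarrow T$; $N\Leftarrow\top$ always; $N\Leftarrow S_1\wedge S_2$ if $N\Leftarrow S_1$ and $N\Leftarrow S_2$. Here $\le$ is the reflexive-transitive closure of $s_1\,N_1\cdots N_n\le s_2\,N_1\cdots N_n$ for $s_1\le s_2\in\Sigma$. - $\Gamma\vdash Q\sqsubset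 P\Rightarrow L$: $s\sqsubset a\Rightarrow L$ if $s{\sqsubset}a{::}L\in\Sigma$; if $Q\sqsubset P\Rightarrow\Pi x{::}S{\sqsubset}A.L$, $N\Leftarrow S$ and $[N/x]_A L=L'$ then $Q\,N\sqsubset P\,N\Rightarrow L'$; and from $L_1\wedge L_2$ to $L_1$ and to $L_2$. - $\Gamma\vdash S\sqsubset A$: $Q\sqsubset P$ if $Q\sqsubset P\Rightarrow\mathsf{sort}$; $\Pi x{::}S{\sqsubset}A.T\sqsubset\Pi x{:}A.B$ if $S\sqsubset A$ and $\Gamma,x{::}S{\sqsubset}A\vdash T\sqsubset B$; $\top\sqsubset A$ always; $S_1\wedge S_2\sqsubset A$ if $S_1\sqsubset A$ and $S_2\sqsubset A$. The judgment $\Gamma\vdash L\sqsubset K$ is defined analogously, with $\mathsf{sort}\sqsubset\mathsf{type}$. - A context is well formed if each of its declarations $x{::}S{\sqsubset}A$ satisfies $S\sqsubset A$ over the preceding ones. A signature is well formed if in each declaration, relative to the preceding ones, $K$ in $a{:}K$ is an LF kind and $A$ in $c{:}A$ is an LF type (both closed); in $s{\sqsubset}a{::}L$, $a{:}K$ is declared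 and $\cdot\vdash L\sqsubset K$; in $c{::}S$, $c{:}A$ is declared and $\cdot\vdash S\sqsubset A$; in $s_1\le s_2$, both $s_i{\sqsubset}a{::}L$ are declared with the same $a$ and $L$; and nothing is declared twice in the same form ($a{:}$, $c{:}$, $s{\sqsubset}$, $c{::}$). **Theorem.** Let $\Sigma$ be a well-formed signature, $\Gamma$ a context such that $\Gamma$ is well formed and $|\Gamma|$ is a well-formed LF context, $A$ a well-formed LF type over $|\Gamma|$, and $S$ a sort with $\Gamma\vdash S\sqsubset A$. 1. (Expansion) If $\Gamma\vdash R\Rightarrow S$, then $\Gamma\vdash\eta_A(R)\Leftarrow S$. If moreover $|\Gamma|\vdash R\Rightarrow A$ in LF, then also $|\Gamma|\vdash\eta_A(R)\Leftarrow A$ in LF. 2. (Identity) $\Gamma,x{::}S{\sqsubset}A\vdash\eta_A(x)\Leftarrow S$, and $|\Gamma|,x{:}A\vdash\eta_A(x)\Leftarrow A$ in LF. -/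

import Mathlib

/-!
LF with refinements (LFR), in canonical-forms style. Variables are de Bruijn indices and contexts
are lists whose head is the most recent declaration, so terms are taken up to α-equivalence.
-/

namespace LFR

/-- Identifiers of the type constants `a`. -/
abbrev TConst := ℕ
/-- Identifiers of the term constants `c`. -/
abbrev OConst := ℕ
/-- Identifiers of the sort constants `s`. -/
abbrev SConst := ℕ

/-! ### Grammar -/

mutual
/-- Atomic terms `R ::= c | x | R N`. -/
inductive Atm : Type
  | const : OConst → Atm
  | var : ℕ → Atm
  | app : Atm → Nrm → Atm
/-- Normal terms `N ::= R | λx. N`. -/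
inductive Nrm : Type
  | atom : Atm → Nrm
  | lam : Nrm → Nrm
end

/-- Atomic type families `P ::= a | P N`. -/
inductive ATy : Type
  | const : TConst → ATy
  | app : ATy → Nrm → ATy

/-- Normal type families `A ::= P | Πx:A. B`. -/
inductive Ty : Type
  | atom : ATy → Ty
  | pi : Ty → Ty → Ty

/-- Kinds `K ::= type | Πx:A. K`. -/
inductive Knd : Type
  | type : Knd
  | pi : Ty → Knd → Knd

/-- Atomic sort families `Q ::= s | Q N`. -/
inductive ASrt : Type
  | const : SConst → ASrt
  | app : ASrt → Nrm → ASrt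

/-- Normal sort families `S ::= Q | Πx::S⊏A. T | ⊤ | S₁ ∧ S₂`. -/
inductive Srt : Type
  | atom : ASrt → Srt
  | pi : Srt → Ty → Srt → Srt
  | top : Srt
  | inter : Srt → Srt → Srt

/-- Classes `L ::= sort | Πx::S⊏A. L | ⊤ | L₁ ∧ L₂`. -/
inductive Cls : Type
  | sort : Cls
  | pi : Srt → Ty → Cls → Cls
  | top : Cls
  | inter : Cls → Cls → Cls

/-- Simple types `α ::= a | α₁ → α₂`. -/
inductive STy : Type
  | base : TConst → STy
  | arr : STy → STy → STy

/-- LF declarations `a : K` and `c : A`. -/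
inductive LFDecl : Type
  | ty : TConst → Knd → LFDecl
  | tm : OConst → Ty → LFDecl

/-- LF signatures; the head of the list is the last declaration. -/
abbrev LFSig := List LFDecl

/-- LF contexts; the head of the list is the last declaration. -/
abbrev LFCtx := List Ty

/-- LFR declarations: `a : K`, `c : A`, `s ⊏ a :: L`, `s₁ ≤ s₂` and `c :: S`. -/
inductive Decl : Type
  | ty : TConst → Knd → Decl
  | tm : OConst → Ty → Decl
  | srt : SConst → TConst → Cls → Decl
  | sub : SConst → SConst → Decl
  | tmSrt : OConst → Srt → Decl

/-- LFR signatures; the head of the list is the last declaration. -/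
abbrev Sig := List Decl

/-- LFR contexts, lists of declarations `x :: S ⊏ A`; the head is the last declaration. -/
abbrev Ctx := List (Srt × Ty)

/-! ### Erasures -/

/-- The simple type of an atomic type family, i.e. its head. -/
def ATy.erase : ATy → STy
  | .const a => .base a
  | .app P _ => P.erase

/-- Erasure of dependencies from a type. -/
def Ty.erase : Ty → STy
  | .atom P => P.erase
  | .pi A B => .arr A.erase B.erase

/-- The LF part of a declaration, if there is one. -/
def Decl.eraseRefs : Decl → Option LFDecl
  | .ty a K => some (.ty a K)
  | .tm c A => some (.tm c A)
  | .srt _ _ _ => none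
  | .sub _ _ => none
  | .tmSrt _ _ => none

/-- Erasure of refinements from a signature. -/
def eraseSig (Sg : Sig) : LFSig := Sg.filterMap Decl.eraseRefs

/-- Erasure of refinements from a context. -/
def eraseCtx (Γ : Ctx) : LFCtx := Γ.map Prod.snd

/-! ### Renaming and weakening -/

/-- The extension of a renaming under one binder. -/
def upRen (ρ : ℕ → ℕ) : ℕ → ℕ
  | 0 => 0
  | i + 1 => ρ i + 1

mutual
def Atm.ren (ρ : ℕ → ℕ) : Atm → Atm
  | .const c => .const c
  | .var i => .var (ρ i)
  | .app R N => .app (R.ren ρ) (N.ren ρ)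
def Nrm.ren (ρ : ℕ → ℕ) : Nrm → Nrm
  | .atom R => .atom (R.ren ρ)
  | .lam N => .lam (N.ren (upRen ρ))
end

def ATy.ren (ρ : ℕ → ℕ) : ATy → ATy
  | .const a => .const a
  | .app P N => .app (P.ren ρ) (N.ren ρ)

def Ty.ren (ρ : ℕ → ℕ) : Ty → Ty
  | .atom P => .atom (P.ren ρ)
  | .pi A B => .pi (A.ren ρ) (B.ren (upRen ρ))

def ASrt.ren (ρ : ℕ → ℕ) : ASrt → ASrt
  | .const s => .const s
  | .app Q N => .app (Q.ren ρ) (N.ren ρ)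

def Srt.ren (ρ : ℕ → ℕ) : Srt → Srt
  | .atom Q => .atom (Q.ren ρ)
  | .pi S A T => .pi (S.ren ρ) (A.ren ρ) (T.ren (upRen ρ))
  | .top => .top
  | .inter S T => .inter (S.ren ρ) (T.ren ρ)

/-- Weakening by one new last variable. -/
def Atm.wk (R : Atm) : Atm := R.ren Nat.succ
/-- Weakening by one new last variable. -/
def Nrm.wk (N : Nrm) : Nrm := N.ren Nat.succ
/-- Weakening by one new last variable. -/
def Ty.wk (A : Ty) : Ty := A.ren Nat.succ
/-- Weakening by one new last variable. -/
def Srt.wk (S : Srt) : Srt := S.ren Nat.succ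

/-! ### η-expansion -/

/-- `η_a(R) = R` and `η_{α → β}(R) = λx. η_β(R (η_α(x)))`. -/
def expand : STy → Atm → Nrm
  | .base _, R => .atom R
  | .arr α β, R => .lam (expand β (.app R.wk (expand α (.var 0))))

/-! ### Hereditary substitution

`HSubst… N₀ k α₀ X Xr` is `[N₀/x₀]_{α₀} X = Xr` where `x₀` is the variable with index `k`. The
variable `x₀` does not exist in the scope of `N₀` and `Xr`, so indices above `k` drop by one. -/

mutual
/-- Substitution into atomic terms with head other than `x₀`, yielding an atomic term. -/
inductive HSubstRR : Nrm → ℕ → STy → Atm → Atm → Prop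
  | const (N₀ : Nrm) (k : ℕ) (α₀ : STy) (c : OConst) :
      HSubstRR N₀ k α₀ (.const c) (.const c)
  | varLt (N₀ : Nrm) (k : ℕ) (α₀ : STy) (i : ℕ) :
      i < k → HSubstRR N₀ k α₀ (.var i) (.var i)
  | varGt (N₀ : Nrm) (k : ℕ) (α₀ : STy) (i : ℕ) :
      k ≤ i → HSubstRR N₀ k α₀ (.var (i + 1)) (.var i)
  | app {N₀ : Nrm} {k : ℕ} {α₀ : STy} {R₁ Rr₁ : Atm} {N₂ Nr₂ : Nrm} :
      HSubstRR N₀ k α₀ R₁ Rr₁ → HSubstN N₀ k α₀ N₂ Nr₂ →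
      HSubstRR N₀ k α₀ (.app R₁ N₂) (.app Rr₁ Nr₂)
/-- Substitution into atomic terms with head `x₀`, yielding a normal term and its simple type. -/
inductive HSubstRN : Nrm → ℕ → STy → Atm → Nrm → STy → Prop
  | var (N₀ : Nrm) (k : ℕ) (α₀ : STy) : HSubstRN N₀ k α₀ (.var k) N₀ α₀
  | beta {N₀ : Nrm} {k : ℕ} {α₀ : STy} {R₁ : Atm} {N₁ Nr₁ N₂ Nr₂ : Nrm} {α₁ α₂ : STy} :
      HSubstRN N₀ k α₀ R₁ (.lam N₁) (.arr α₂ α₁) → HSubstN N₀ k α₀ N₂ Nr₂ →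
      HSubstN Nr₂ 0 α₂ N₁ Nr₁ →
      HSubstRN N₀ k α₀ (.app R₁ N₂) Nr₁ α₁
/-- Substitution into normal terms. -/
inductive HSubstN : Nrm → ℕ → STy → Nrm → Nrm → Prop
  | atom {N₀ : Nrm} {k : ℕ} {α₀ : STy} {R Rr : Atm} :
      HSubstRR N₀ k α₀ R Rr → HSubstN N₀ k α₀ (.atom R) (.atom Rr)
  | atomNorm {N₀ : Nrm} {k : ℕ} {α₀ : STy} {R Rr : Atm} {a : TConst} :
      HSubstRN N₀ k α₀ R (.atom Rr) (.base a) → HSubstN N₀ k α₀ (.atom R) (.atom Rr)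
  | lam {N₀ : Nrm} {k : ℕ} {α₀ : STy} {N Nr : Nrm} :
      HSubstN N₀.wk (k + 1) α₀ N Nr → HSubstN N₀ k α₀ (.lam N) (.lam Nr)
end

/-- Substitution into atomic type families. -/
inductive HSubstP : Nrm → ℕ → STy → ATy → ATy → Prop
  | const (N₀ : Nrm) (k : ℕ) (α₀ : STy) (a : TConst) :
      HSubstP N₀ k α₀ (.const a) (.const a)
  | app {N₀ : Nrm} {k : ℕ} {α₀ : STy} {P Pr : ATy} {N Nr : Nrm} :
      HSubstP N₀ k α₀ P Pr → HSubstN N₀ k α₀ N Nr →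
      HSubstP N₀ k α₀ (.app P N) (.app Pr Nr)

/-- Substitution into normal type families. -/
inductive HSubstA : Nrm → ℕ → STy → Ty → Ty → Prop
  | atom {N₀ : Nrm} {k : ℕ} {α₀ : STy} {P Pr : ATy} :
      HSubstP N₀ k α₀ P Pr → HSubstA N₀ k α₀ (.atom P) (.atom Pr)
  | pi {N₀ : Nrm} {k : ℕ} {α₀ : STy} {A Ar B Br : Ty} :
      HSubstA N₀ k α₀ A Ar → HSubstA N₀.wk (k + 1) α₀ B Br →
      HSubstA N₀ k α₀ (.pi A B) (.pi Ar Br)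

/-- Substitution into kinds. -/
inductive HSubstK : Nrm → ℕ → STy → Knd → Knd → Prop
  | type (N₀ : Nrm) (k : ℕ) (α₀ : STy) : HSubstK N₀ k α₀ .type .type
  | pi {N₀ : Nrm} {k : ℕ} {α₀ : STy} {A Ar : Ty} {K Kr : Knd} :
      HSubstA N₀ k α₀ A Ar → HSubstK N₀.wk (k + 1) α₀ K Kr →
      HSubstK N₀ k α₀ (.pi A K) (.pi Ar Kr)

/-- Substitution into atomic sort families. -/
inductive HSubstQ : Nrm → ℕ → STy → ASrt → ASrt → Prop
  | const (N₀ : Nrm) (k : ℕ) (α₀ : STy) (s : SConst) :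
      HSubstQ N₀ k α₀ (.const s) (.const s)
  | app {N₀ : Nrm} {k : ℕ} {α₀ : STy} {Q Qr : ASrt} {N Nr : Nrm} :
      HSubstQ N₀ k α₀ Q Qr → HSubstN N₀ k α₀ N Nr →
      HSubstQ N₀ k α₀ (.app Q N) (.app Qr Nr)

/-- Substitution into normal sort families. -/
inductive HSubstS : Nrm → ℕ → STy → Srt → Srt → Prop
  | atom {N₀ : Nrm} {k : ℕ} {α₀ : STy} {Q Qr : ASrt} :
      HSubstQ N₀ k α₀ Q Qr → HSubstS N₀ k α₀ (.atom Q) (.atom Qr)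
  | pi {N₀ : Nrm} {k : ℕ} {α₀ : STy} {S Sr T Tr : Srt} {A Ar : Ty} :
      HSubstS N₀ k α₀ S Sr → HSubstA N₀ k α₀ A Ar → HSubstS N₀.wk (k + 1) α₀ T Tr →
      HSubstS N₀ k α₀ (.pi S A T) (.pi Sr Ar Tr)
  | top (N₀ : Nrm) (k : ℕ) (α₀ : STy) : HSubstS N₀ k α₀ .top .top
  | inter {N₀ : Nrm} {k : ℕ} {α₀ : STy} {S₁ Sr₁ S₂ Sr₂ : Srt} :
      HSubstS N₀ k α₀ S₁ Sr₁ → HSubstS N₀ k α₀ S₂ Sr₂ →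
      HSubstS N₀ k α₀ (.inter S₁ S₂) (.inter Sr₁ Sr₂)

/-- Substitution into classes. -/
inductive HSubstL : Nrm → ℕ → STy → Cls → Cls → Prop
  | sort (N₀ : Nrm) (k : ℕ) (α₀ : STy) : HSubstL N₀ k α₀ .sort .sort
  | pi {N₀ : Nrm} {k : ℕ} {α₀ : STy} {S Sr : Srt} {A Ar : Ty} {L Lr : Cls} :
      HSubstS N₀ k α₀ S Sr → HSubstA N₀ k α₀ A Ar → HSubstL N₀.wk (k + 1) α₀ L Lr →
      HSubstL N₀ k α₀ (.pi S A L) (.pi Sr Ar Lr)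
  | top (N₀ : Nrm) (k : ℕ) (α₀ : STy) : HSubstL N₀ k α₀ .top .top
  | inter {N₀ : Nrm} {k : ℕ} {α₀ : STy} {L₁ Lr₁ L₂ Lr₂ : Cls} :
      HSubstL N₀ k α₀ L₁ Lr₁ → HSubstL N₀ k α₀ L₂ Lr₂ →
      HSubstL N₀ k α₀ (.inter L₁ L₂) (.inter Lr₁ Lr₂)

/-! ### Canonical LF -/

/-- `x : A ∈ Γ`, where `x` has the given index and `A` is read in the whole context `Γ`. -/
inductive LFLookup : LFCtx → ℕ → Ty → Prop
  | zero (Γ : LFCtx) (A : Ty) : LFLookup (A :: Γ) 0 A.wk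
  | succ {Γ : LFCtx} {i : ℕ} {A : Ty} (B : Ty) :
      LFLookup Γ i A → LFLookup (B :: Γ) (i + 1) A.wk

mutual
/-- LF synthesis `Γ ⊢ R ⇒ A`. -/
inductive LFSynth (Sg : LFSig) : LFCtx → Atm → Ty → Prop
  | const {Γ : LFCtx} {c : OConst} {A : Ty} :
      LFDecl.tm c A ∈ Sg → LFSynth Sg Γ (.const c) A
  | var {Γ : LFCtx} {i : ℕ} {A : Ty} : LFLookup Γ i A → LFSynth Sg Γ (.var i) A
  | app {Γ : LFCtx} {R : Atm} {N : Nrm} {A B Br : Ty} :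
      LFSynth Sg Γ R (.pi A B) → LFCheck Sg Γ N A → HSubstA N 0 A.erase B Br →
      LFSynth Sg Γ (.app R N) Br
/-- LF checking `Γ ⊢ N ⇐ A`. -/
inductive LFCheck (Sg : LFSig) : LFCtx → Nrm → Ty → Prop
  | atom {Γ : LFCtx} {R : Atm} {P : ATy} :
      LFSynth Sg Γ R (.atom P) → LFCheck Sg Γ (.atom R) (.atom P)
  | lam {Γ : LFCtx} {N : Nrm} {A B : Ty} :
      LFCheck Sg (A :: Γ) N B → LFCheck Sg Γ (.lam N) (.pi A B)
end

/-- Kind synthesis `Γ ⊢ P ⇒ K`. -/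
inductive LFKindSynth (Sg : LFSig) : LFCtx → ATy → Knd → Prop
  | const {Γ : LFCtx} {a : TConst} {K : Knd} :
      LFDecl.ty a K ∈ Sg → LFKindSynth Sg Γ (.const a) K
  | app {Γ : LFCtx} {P : ATy} {N : Nrm} {A : Ty} {K Kr : Knd} :
      LFKindSynth Sg Γ P (.pi A K) → LFCheck Sg Γ N A → HSubstK N 0 A.erase K Kr →
      LFKindSynth Sg Γ (.app P N) Kr

/-- Well-formed types `Γ ⊢ A ⇐ type`. -/
inductive LFTyOk (Sg : LFSig) : LFCtx → Ty → Prop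
  | atom {Γ : LFCtx} {P : ATy} : LFKindSynth Sg Γ P .type → LFTyOk Sg Γ (.atom P)
  | pi {Γ : LFCtx} {A B : Ty} :
      LFTyOk Sg Γ A → LFTyOk Sg (A :: Γ) B → LFTyOk Sg Γ (.pi A B)

/-- Well-formed kinds `Γ ⊢ K ⇐ kind`. -/
inductive LFKndOk (Sg : LFSig) : LFCtx → Knd → Prop
  | type (Γ : LFCtx) : LFKndOk Sg Γ .type
  | pi {Γ : LFCtx} {A : Ty} {K : Knd} :
      LFTyOk Sg Γ A → LFKndOk Sg (A :: Γ) K → LFKndOk Sg Γ (.pi A K)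

/-- Well-formed LF contexts. -/
inductive LFCtxOk (Sg : LFSig) : LFCtx → Prop
  | nil : LFCtxOk Sg []
  | cons {Γ : LFCtx} {A : Ty} : LFCtxOk Sg Γ → LFTyOk Sg Γ A → LFCtxOk Sg (A :: Γ)

/-! ### Refinements -/

/-- `x :: S ⊏ A ∈ Γ`, where `x` has the given index and `S`, `A` are read in all of `Γ`. -/
inductive Lookup : Ctx → ℕ → Srt → Ty → Prop
  | zero (Γ : Ctx) (S : Srt) (A : Ty) : Lookup ((S, A) :: Γ) 0 S.wk A.wk
  | succ {Γ : Ctx} {i : ℕ} {S : Srt} {A : Ty} (D : Srt × Ty) :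
      Lookup Γ i S A → Lookup (D :: Γ) (i + 1) S.wk A.wk

/-- One declared subsorting step `s₁ N₁ … Nₙ ≤ s₂ N₁ … Nₙ`, where `s₁ ≤ s₂ ∈ Σ`. -/
inductive SubStep (Sg : Sig) : ASrt → ASrt → Prop
  | const {s₁ s₂ : SConst} : Decl.sub s₁ s₂ ∈ Sg → SubStep Sg (.const s₁) (.const s₂)
  | app {Q₁ Q₂ : ASrt} (N : Nrm) :
      SubStep Sg Q₁ Q₂ → SubStep Sg (.app Q₁ N) (.app Q₂ N)

/-- Subsorting `Q₁ ≤ Q₂` on atomic sorts. -/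
inductive Subsort (Sg : Sig) : ASrt → ASrt → Prop
  | refl (Q : ASrt) : Subsort Sg Q Q
  | step {Q₁ Qr Q₂ : ASrt} : SubStep Sg Q₁ Qr → Subsort Sg Qr Q₂ → Subsort Sg Q₁ Q₂

mutual
/-- Sort synthesis `Γ ⊢ R ⇒ S`. -/
inductive Synth (Sg : Sig) : Ctx → Atm → Srt → Prop
  | const {Γ : Ctx} {c : OConst} {S : Srt} :
      Decl.tmSrt c S ∈ Sg → Synth Sg Γ (.const c) S
  | var {Γ : Ctx} {i : ℕ} {S : Srt} {A : Ty} : Lookup Γ i S A → Synth Sg Γ (.var i) S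
  | app {Γ : Ctx} {R : Atm} {N : Nrm} {S T Tr : Srt} {A : Ty} :
      Synth Sg Γ R (.pi S A T) → Check Sg Γ N S → HSubstS N 0 A.erase T Tr →
      Synth Sg Γ (.app R N) Tr
  | interLeft {Γ : Ctx} {R : Atm} {S₁ S₂ : Srt} :
      Synth Sg Γ R (.inter S₁ S₂) → Synth Sg Γ R S₁
  | interRight {Γ : Ctx} {R : Atm} {S₁ S₂ : Srt} :
      Synth Sg Γ R (.inter S₁ S₂) → Synth Sg Γ R S₂
/-- Sort checking `Γ ⊢ N ⇐ S`. -/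
inductive Check (Sg : Sig) : Ctx → Nrm → Srt → Prop
  | switch {Γ : Ctx} {R : Atm} {Qr Q : ASrt} :
      Synth Sg Γ R (.atom Qr) → Subsort Sg Qr Q → Check Sg Γ (.atom R) (.atom Q)
  | lam {Γ : Ctx} {N : Nrm} {S T : Srt} {A : Ty} :
      Check Sg ((S, A) :: Γ) N T → Check Sg Γ (.lam N) (.pi S A T)
  | top (Γ : Ctx) (N : Nrm) : Check Sg Γ N .top
  | inter {Γ : Ctx} {N : Nrm} {S₁ S₂ : Srt} :
      Check Sg Γ N S₁ → Check Sg Γ N S₂ → Check Sg Γ N (.inter S₁ S₂)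
end

/-- Class synthesis `Γ ⊢ Q ⊏ P ⇒ L`. -/
inductive ClsSynth (Sg : Sig) : Ctx → ASrt → ATy → Cls → Prop
  | const {Γ : Ctx} {s : SConst} {a : TConst} {L : Cls} :
      Decl.srt s a L ∈ Sg → ClsSynth Sg Γ (.const s) (.const a) L
  | app {Γ : Ctx} {Q : ASrt} {P : ATy} {N : Nrm} {S : Srt} {A : Ty} {L Lr : Cls} :
      ClsSynth Sg Γ Q P (.pi S A L) → Check Sg Γ N S → HSubstL N 0 A.erase L Lr →
      ClsSynth Sg Γ (.app Q N) (.app P N) Lr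
  | interLeft {Γ : Ctx} {Q : ASrt} {P : ATy} {L₁ L₂ : Cls} :
      ClsSynth Sg Γ Q P (.inter L₁ L₂) → ClsSynth Sg Γ Q P L₁
  | interRight {Γ : Ctx} {Q : ASrt} {P : ATy} {L₁ L₂ : Cls} :
      ClsSynth Sg Γ Q P (.inter L₁ L₂) → ClsSynth Sg Γ Q P L₂

/-- Sort formation `Γ ⊢ S ⊏ A`. -/
inductive SrtOk (Sg : Sig) : Ctx → Srt → Ty → Prop
  | atom {Γ : Ctx} {Q : ASrt} {P : ATy} :
      ClsSynth Sg Γ Q P .sort → SrtOk Sg Γ (.atom Q) (.atom P)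
  | pi {Γ : Ctx} {S T : Srt} {A B : Ty} :
      SrtOk Sg Γ S A → SrtOk Sg ((S, A) :: Γ) T B →
      SrtOk Sg Γ (.pi S A T) (.pi A B)
  | top (Γ : Ctx) (A : Ty) : SrtOk Sg Γ .top A
  | inter {Γ : Ctx} {S₁ S₂ : Srt} {A : Ty} :
      SrtOk Sg Γ S₁ A → SrtOk Sg Γ S₂ A → SrtOk Sg Γ (.inter S₁ S₂) A

/-- Class formation `Γ ⊢ L ⊏ K`. -/
inductive ClsOk (Sg : Sig) : Ctx → Cls → Knd → Prop
  | sort (Γ : Ctx) : ClsOk Sg Γ .sort .type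
  | pi {Γ : Ctx} {S : Srt} {A : Ty} {L : Cls} {K : Knd} :
      SrtOk Sg Γ S A → ClsOk Sg ((S, A) :: Γ) L K → ClsOk Sg Γ (.pi S A L) (.pi A K)
  | top (Γ : Ctx) (K : Knd) : ClsOk Sg Γ .top K
  | inter {Γ : Ctx} {L₁ L₂ : Cls} {K : Knd} :
      ClsOk Sg Γ L₁ K → ClsOk Sg Γ L₂ K → ClsOk Sg Γ (.inter L₁ L₂) K

/-- Well-formed contexts. -/
inductive CtxOk (Sg : Sig) : Ctx → Prop
  | nil : CtxOk Sg []
  | cons {Γ : Ctx} {S : Srt} {A : Ty} :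
      CtxOk Sg Γ → SrtOk Sg Γ S A → CtxOk Sg ((S, A) :: Γ)

/-- Well-formed signatures. -/
inductive SigOk : Sig → Prop
  | nil : SigOk []
  | ty {Sg : Sig} {a : TConst} {K : Knd} :
      SigOk Sg → LFKndOk (eraseSig Sg) [] K → (∀ Kr, Decl.ty a Kr ∉ Sg) →
      SigOk (.ty a K :: Sg)
  | tm {Sg : Sig} {c : OConst} {A : Ty} :
      SigOk Sg → LFTyOk (eraseSig Sg) [] A → (∀ Ar, Decl.tm c Ar ∉ Sg) →
      SigOk (.tm c A :: Sg)
  | srt {Sg : Sig} {s : SConst} {a : TConst} {L : Cls} {K : Knd} :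
      SigOk Sg → Decl.ty a K ∈ Sg → ClsOk Sg [] L K → (∀ ar Lr, Decl.srt s ar Lr ∉ Sg) →
      SigOk (.srt s a L :: Sg)
  | tmSrt {Sg : Sig} {c : OConst} {S : Srt} {A : Ty} :
      SigOk Sg → Decl.tm c A ∈ Sg → SrtOk Sg [] S A → (∀ Sr, Decl.tmSrt c Sr ∉ Sg) →
      SigOk (.tmSrt c S :: Sg)
  | sub {Sg : Sig} {s₁ s₂ : SConst} {a : TConst} {L : Cls} :
      SigOk Sg → Decl.srt s₁ a L ∈ Sg → Decl.srt s₂ a L ∈ Sg →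
      SigOk (.sub s₁ s₂ :: Sg)

end LFR

open LFR

/-!
Both parts rest on the identity property `[η_α(y)/x] X = X[y/x]` of hereditary substitution: in the
case `A = Π x:A₁. A₂` of the expansion, `R (η_{A₁}(x))` synthesizes `[η_{A₁}(x)/x]` applied to the
codomain, which has to be the codomain again. The identity property only needs simple types. When
`x` is the head of a term `x N₁ ⋯ Nₙ`, the redexes created by `η_α(y)` are of the form
`[Nᵢ/z] η_β(z)` with `β` an argument type of `α`, hence smaller than `α`; that these evaluate to
`Nᵢ` is proved simultaneously, by lexicographic induction on the simple type and the term.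
A sort refining `A` contains no terms but those of `A`, so the property passes from types to sorts.
-/

namespace LFR

/-! ### Renaming -/

theorem upRen_comp (ρ ξ : ℕ → ℕ) : upRen ρ ∘ upRen ξ = upRen (ρ ∘ ξ) := by
  funext i
  cases i <;> rfl

theorem upRen_comp_succ (ρ : ℕ → ℕ) : upRen ρ ∘ Nat.succ = Nat.succ ∘ ρ := rfl

theorem upRen_eq_self {ρ : ℕ → ℕ} {n : ℕ} (hρ : ∀ i < n, ρ i = i) : ∀ i < n + 1, upRen ρ i = i
  | 0, _ => rfl
  | i + 1, hi => congrArg Nat.succ (hρ i (Nat.lt_of_succ_lt_succ hi))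

mutual
theorem Atm.ren_ren (ρ ξ : ℕ → ℕ) : ∀ R : Atm, (R.ren ξ).ren ρ = R.ren (ρ ∘ ξ)
  | .const _ => rfl
  | .var _ => rfl
  | .app R N => by simp only [Atm.ren, R.ren_ren, N.ren_ren]
theorem Nrm.ren_ren (ρ ξ : ℕ → ℕ) : ∀ N : Nrm, (N.ren ξ).ren ρ = N.ren (ρ ∘ ξ)
  | .atom R => by simp only [Nrm.ren, R.ren_ren]
  | .lam N => by simp only [Nrm.ren, N.ren_ren, upRen_comp]
end

theorem ATy.ren_ren (ρ ξ : ℕ → ℕ) : ∀ P : ATy, (P.ren ξ).ren ρ = P.ren (ρ ∘ ξ)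
  | .const _ => rfl
  | .app P N => by simp only [ATy.ren, P.ren_ren, N.ren_ren]

theorem Ty.ren_ren (ρ ξ : ℕ → ℕ) : ∀ A : Ty, (A.ren ξ).ren ρ = A.ren (ρ ∘ ξ)
  | .atom P => by simp only [Ty.ren, P.ren_ren]
  | .pi A B => by simp only [Ty.ren, A.ren_ren, B.ren_ren, upRen_comp]

theorem ASrt.ren_ren (ρ ξ : ℕ → ℕ) : ∀ Q : ASrt, (Q.ren ξ).ren ρ = Q.ren (ρ ∘ ξ)
  | .const _ => rfl
  | .app Q N => by simp only [ASrt.ren, Q.ren_ren, N.ren_ren]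

theorem Srt.ren_ren (ρ ξ : ℕ → ℕ) : ∀ S : Srt, (S.ren ξ).ren ρ = S.ren (ρ ∘ ξ)
  | .atom Q => by simp only [Srt.ren, Q.ren_ren]
  | .pi S A T => by simp only [Srt.ren, S.ren_ren, A.ren_ren, T.ren_ren, upRen_comp]
  | .top => rfl
  | .inter S T => by simp only [Srt.ren, S.ren_ren, T.ren_ren]

theorem Atm.ren_upRen_wk (ρ : ℕ → ℕ) (R : Atm) : R.wk.ren (upRen ρ) = (R.ren ρ).wk := by
  simp only [Atm.wk, Atm.ren_ren, upRen_comp_succ]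

theorem Nrm.ren_upRen_wk (ρ : ℕ → ℕ) (N : Nrm) : N.wk.ren (upRen ρ) = (N.ren ρ).wk := by
  simp only [Nrm.wk, Nrm.ren_ren, upRen_comp_succ]

theorem Ty.ren_upRen_wk (ρ : ℕ → ℕ) (A : Ty) : A.wk.ren (upRen ρ) = (A.ren ρ).wk := by
  simp only [Ty.wk, Ty.ren_ren, upRen_comp_succ]

theorem Srt.ren_upRen_wk (ρ : ℕ → ℕ) (S : Srt) : S.wk.ren (upRen ρ) = (S.ren ρ).wk := by
  simp only [Srt.wk, Srt.ren_ren, upRen_comp_succ]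

theorem ATy.erase_ren (ρ : ℕ → ℕ) : ∀ P : ATy, (P.ren ρ).erase = P.erase
  | .const _ => rfl
  | .app P _ => P.erase_ren ρ

theorem Ty.erase_ren (ρ : ℕ → ℕ) : ∀ A : Ty, (A.ren ρ).erase = A.erase
  | .atom P => P.erase_ren ρ
  | .pi A B => by simp only [Ty.ren, Ty.erase, A.erase_ren, B.erase_ren]

theorem Ty.erase_wk (A : Ty) : A.wk.erase = A.erase := A.erase_ren _

theorem expand_ren (ρ : ℕ → ℕ) (α : STy) (R : Atm) :
    (expand α R).ren ρ = expand α (R.ren ρ) := by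
  induction α generalizing ρ R with
  | base => rfl
  | arr α β ihα ihβ => simp only [expand, Nrm.ren, ihβ, Atm.ren, ihα, Atm.ren_upRen_wk, upRen]

theorem expand_erase (R : Atm) : ∀ P : ATy, expand P.erase R = .atom R
  | .const _ => rfl
  | .app P _ => expand_erase R P

/-- The renaming that inserts a new variable with index `k`. Its image is exactly the set of
variables that a substitution for `k` does not replace. -/
def skip (k i : ℕ) : ℕ := if i < k then i else i + 1

theorem skip_of_lt {k i : ℕ} (h : i < k) : skip k i = i := if_pos h

theorem skip_of_le {k i : ℕ} (h : k ≤ i) : skip k i = i + 1 := if_neg h.not_gt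

theorem upRen_skip (k : ℕ) : upRen (skip k) = skip (k + 1) := by
  funext i
  cases i with
  | zero => rfl
  | succ i =>
    rcases lt_or_ge i k with h | h
    · rw [upRen, skip_of_lt h, skip_of_lt (Nat.succ_lt_succ h)]
    · rw [upRen, skip_of_le h, skip_of_le (Nat.succ_le_succ h)]

theorem upRen_succ : upRen Nat.succ = skip 1 := upRen_skip 0

/-! ### Hereditary substitution and renaming -/

/-- The compatibility of a renaming `ρ` of the source and a renaming `ξ` of the target of a
substitution for `k`, under which it is turned into a substitution for `l`. -/
def SubstRen (ρ ξ : ℕ → ℕ) (k l : ℕ) : Prop := ρ k = l ∧ ∀ i, ρ (skip k i) = skip l (ξ i)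

theorem SubstRen.up {ρ ξ : ℕ → ℕ} {k l : ℕ}
    (h : SubstRen ρ ξ k l) : SubstRen (upRen ρ) (upRen ξ) (k + 1) (l + 1) := by
  refine ⟨congrArg Nat.succ h.1, fun i => ?_⟩
  rw [← upRen_skip, ← upRen_skip]
  cases i with
  | zero => rfl
  | succ i => exact congrArg Nat.succ (h.2 i)

theorem SubstRen.zero (ξ : ℕ → ℕ) : SubstRen (upRen ξ) ξ 0 0 := ⟨rfl, fun _ => rfl⟩

theorem SubstRen.succ (k : ℕ) : SubstRen Nat.succ Nat.succ k (k + 1) :=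
  ⟨rfl, fun i => by rw [← upRen_skip]; rfl⟩

theorem HSubstRR.var_skip (N₀ : Nrm) (k : ℕ) (α₀ : STy) (i : ℕ) :
    HSubstRR N₀ k α₀ (.var (skip k i)) (.var i) := by
  rcases lt_or_ge i k with h | h
  · rw [skip_of_lt h]
    exact .varLt _ _ _ _ h
  · rw [skip_of_le h]
    exact .varGt _ _ _ _ h

mutual
theorem HSubstRR.ren {ρ ξ : ℕ → ℕ} {N₀ : Nrm} {k l : ℕ} {α₀ : STy} {R Rr : Atm}
    (hρ : SubstRen ρ ξ k l) :
    HSubstRR N₀ k α₀ R Rr → HSubstRR (N₀.ren ξ) l α₀ (R.ren ρ) (Rr.ren ξ)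
  | .const _ _ _ c => .const _ _ _ c
  | .varLt _ _ _ i hi => by
      have hi' := hρ.2 i
      rw [skip_of_lt hi] at hi'
      rw [Atm.ren, hi']
      exact .var_skip _ _ _ _
  | .varGt _ _ _ i hi => by
      have hi' := hρ.2 i
      rw [skip_of_le hi] at hi'
      rw [Atm.ren, hi']
      exact .var_skip _ _ _ _
  | .app hR hN => .app (hR.ren hρ) (hN.ren hρ)
theorem HSubstRN.ren {ρ ξ : ℕ → ℕ} {N₀ : Nrm} {k l : ℕ} {α₀ α : STy} {R : Atm} {N : Nrm}
    (hρ : SubstRen ρ ξ k l) :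
    HSubstRN N₀ k α₀ R N α → HSubstRN (N₀.ren ξ) l α₀ (R.ren ρ) (N.ren ξ) α
  | .var _ _ _ => by
      rw [Atm.ren, hρ.1]
      exact .var _ _ _
  | .beta hR hN hβ => .beta (hR.ren hρ) (hN.ren hρ) (hβ.ren (.zero ξ))
theorem HSubstN.ren {ρ ξ : ℕ → ℕ} {N₀ : Nrm} {k l : ℕ} {α₀ : STy} {N Nr : Nrm}
    (hρ : SubstRen ρ ξ k l) :
    HSubstN N₀ k α₀ N Nr → HSubstN (N₀.ren ξ) l α₀ (N.ren ρ) (Nr.ren ξ)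
  | .atom hR => .atom (hR.ren hρ)
  | .atomNorm hR => .atomNorm (hR.ren hρ)
  | .lam hN => .lam (Nrm.ren_upRen_wk ξ N₀ ▸ hN.ren hρ.up)
end

theorem HSubstP.ren {ρ ξ : ℕ → ℕ} {N₀ : Nrm} {k l : ℕ} {α₀ : STy} {P Pr : ATy}
    (hρ : SubstRen ρ ξ k l) :
    HSubstP N₀ k α₀ P Pr → HSubstP (N₀.ren ξ) l α₀ (P.ren ρ) (Pr.ren ξ)
  | .const _ _ _ a => .const _ _ _ a
  | .app hP hN => .app (hP.ren hρ) (hN.ren hρ)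

theorem HSubstA.ren {ρ ξ : ℕ → ℕ} {N₀ : Nrm} {k l : ℕ} {α₀ : STy} {A Ar : Ty}
    (hρ : SubstRen ρ ξ k l) :
    HSubstA N₀ k α₀ A Ar → HSubstA (N₀.ren ξ) l α₀ (A.ren ρ) (Ar.ren ξ)
  | .atom hP => .atom (hP.ren hρ)
  | .pi hA hB => .pi (hA.ren hρ) (Nrm.ren_upRen_wk ξ N₀ ▸ hB.ren hρ.up)

theorem HSubstQ.ren {ρ ξ : ℕ → ℕ} {N₀ : Nrm} {k l : ℕ} {α₀ : STy} {Q Qr : ASrt}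
    (hρ : SubstRen ρ ξ k l) :
    HSubstQ N₀ k α₀ Q Qr → HSubstQ (N₀.ren ξ) l α₀ (Q.ren ρ) (Qr.ren ξ)
  | .const _ _ _ s => .const _ _ _ s
  | .app hQ hN => .app (hQ.ren hρ) (hN.ren hρ)

theorem HSubstS.ren {ρ ξ : ℕ → ℕ} {N₀ : Nrm} {k l : ℕ} {α₀ : STy} {S Sr : Srt}
    (hρ : SubstRen ρ ξ k l) :
    HSubstS N₀ k α₀ S Sr → HSubstS (N₀.ren ξ) l α₀ (S.ren ρ) (Sr.ren ξ)
  | .atom hQ => .atom (hQ.ren hρ)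
  | .pi hS hA hT => .pi (hS.ren hρ) (hA.ren hρ) (Nrm.ren_upRen_wk ξ N₀ ▸ hT.ren hρ.up)
  | .top _ _ _ => .top _ _ _
  | .inter h₁ h₂ => .inter (h₁.ren hρ) (h₂.ren hρ)

mutual
theorem HSubstRR.ren_skip (N₀ : Nrm) (k : ℕ) (α₀ : STy) :
    ∀ R : Atm, HSubstRR N₀ k α₀ (R.ren (skip k)) R
  | .const c => .const _ _ _ c
  | .var i => .var_skip _ _ _ i
  | .app R N => .app (.ren_skip N₀ k α₀ R) (.ren_skip N₀ k α₀ N)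
theorem HSubstN.ren_skip (N₀ : Nrm) (k : ℕ) (α₀ : STy) :
    ∀ N : Nrm, HSubstN N₀ k α₀ (N.ren (skip k)) N
  | .atom R => .atom (.ren_skip N₀ k α₀ R)
  | .lam N => .lam (upRen_skip k ▸ .ren_skip N₀.wk (k + 1) α₀ N)
end

theorem HSubstRR.wk (N₀ : Nrm) (α₀ : STy) (R : Atm) : HSubstRR N₀ 0 α₀ R.wk R :=
  .ren_skip N₀ 0 α₀ R

theorem HSubstP.erase_eq {N₀ : Nrm} {k : ℕ} {α₀ : STy} {P Pr : ATy} :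
    HSubstP N₀ k α₀ P Pr → Pr.erase = P.erase
  | .const _ _ _ _ => rfl
  | .app hP _ => hP.erase_eq

theorem HSubstA.erase_eq {N₀ : Nrm} {k : ℕ} {α₀ : STy} {A Ar : Ty} :
    HSubstA N₀ k α₀ A Ar → Ar.erase = A.erase
  | .atom hP => hP.erase_eq
  | .pi hA hB => congrArg₂ STy.arr hA.erase_eq hB.erase_eq

theorem HSubstRR.expand {N₀ : Nrm} {k : ℕ} {α₀ : STy} {R Rr : Atm}
    (h : HSubstRR N₀ k α₀ R Rr) (β : STy) :
    HSubstN N₀ k α₀ (expand β R) (expand β Rr) := by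
  induction β generalizing N₀ k R Rr with
  | base => exact .atom h
  | arr β₁ β₂ ih₁ ih₂ =>
    have harg := ih₁ (.varLt N₀.wk (k + 1) α₀ 0 k.succ_pos)
    exact .lam (ih₂ (.app (h.ren (.succ k)) harg))

/-! ### Simple typing -/

mutual
/-- Simple type synthesis for atomic terms. It serves to show that substitutions for variables are
defined, so the signature is ignored and a constant has every simple type. -/
inductive SimpleSynth : List STy → Atm → STy → Prop
  | const (Ψ : List STy) (c : OConst) (α : STy) : SimpleSynth Ψ (.const c) α
  | var {Ψ : List STy} {i : ℕ} {α : STy} : Ψ[i]? = some α → SimpleSynth Ψ (.var i) α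
  | app {Ψ : List STy} {R : Atm} {N : Nrm} {α β : STy} :
      SimpleSynth Ψ R (.arr α β) → SimpleCheck Ψ N α → SimpleSynth Ψ (.app R N) β
/-- Simple type checking for normal terms. As in LF, terms are η-long: atomic terms are checked
only at base types. -/
inductive SimpleCheck : List STy → Nrm → STy → Prop
  | atom {Ψ : List STy} {R : Atm} {a : TConst} :
      SimpleSynth Ψ R (.base a) → SimpleCheck Ψ (.atom R) (.base a)
  | lam {Ψ : List STy} {N : Nrm} {α β : STy} :
      SimpleCheck (α :: Ψ) N β → SimpleCheck Ψ (.lam N) (.arr α β)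
end

/-- Atomic type families all of whose arguments are simply typed, at any types. -/
inductive SimpleATy (Ψ : List STy) : ATy → Prop
  | const (a : TConst) : SimpleATy Ψ (.const a)
  | app {P : ATy} {N : Nrm} {α : STy} :
      SimpleATy Ψ P → SimpleCheck Ψ N α → SimpleATy Ψ (.app P N)

/-- Types in which all terms are simply typed: what the identity property of hereditary
substitution needs of a well-formed type. -/
inductive SimpleTy : List STy → Ty → Prop
  | atom {Ψ : List STy} {P : ATy} : SimpleATy Ψ P → SimpleTy Ψ (.atom P)
  | pi {Ψ : List STy} {A B : Ty} :
      SimpleTy Ψ A → SimpleTy (A.erase :: Ψ) B → SimpleTy Ψ (.pi A B)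

theorem LFLookup.getElem?_map_erase {Γ : LFCtx} {A : Ty} {i : ℕ} (h : LFLookup Γ i A) :
    (Γ.map Ty.erase)[i]? = some A.erase := by
  induction h with
  | zero Γ A => simp only [List.map_cons, List.getElem?_cons_zero, Ty.erase_wk]
  | succ B _ ih => simpa only [List.map_cons, List.getElem?_cons_succ, Ty.erase_wk] using ih

theorem SimpleSynth.check {Ψ : List STy} {R : Atm} :
    ∀ {P : ATy}, SimpleSynth Ψ R P.erase → SimpleCheck Ψ (.atom R) P.erase
  | .const _, hR => .atom hR
  | .app P _, hR => SimpleSynth.check (P := P) hR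

mutual
theorem LFSynth.simpleSynth {Sg : LFSig} {Γ : LFCtx} {R : Atm} {A : Ty} :
    LFSynth Sg Γ R A → SimpleSynth (Γ.map Ty.erase) R A.erase
  | .const _ => .const _ _ _
  | .var hi => .var hi.getElem?_map_erase
  | .app hR hN hB => hB.erase_eq ▸ .app hR.simpleSynth hN.simpleCheck
theorem LFCheck.simpleCheck {Sg : LFSig} {Γ : LFCtx} {N : Nrm} {A : Ty} :
    LFCheck Sg Γ N A → SimpleCheck (Γ.map Ty.erase) N A.erase
  | .atom (P := P) hR => SimpleSynth.check (P := P) hR.simpleSynth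
  | .lam hN => .lam hN.simpleCheck
end

theorem LFKindSynth.simpleATy {Sg : LFSig} {Γ : LFCtx} {P : ATy} {K : Knd} :
    LFKindSynth Sg Γ P K → SimpleATy (Γ.map Ty.erase) P
  | .const _ => .const _
  | .app hP hN _ => .app hP.simpleATy hN.simpleCheck

theorem LFTyOk.simpleTy {Sg : LFSig} {Γ : LFCtx} {A : Ty} :
    LFTyOk Sg Γ A → SimpleTy (Γ.map Ty.erase) A
  | .atom hP => .atom hP.simpleATy
  | .pi hA hB => .pi hA.simpleTy hB.simpleTy

/-- Renamings that map the variables of `Ψ` to variables of `Ψr` with the same simple types; they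
preserve simple typing. -/
def SimpleRen (ρ : ℕ → ℕ) (Ψ Ψr : List STy) : Prop :=
  ∀ i α, Ψ[i]? = some α → Ψr[ρ i]? = some α

theorem SimpleRen.up {Ψ Ψr : List STy} {ρ : ℕ → ℕ}
    (h : SimpleRen ρ Ψ Ψr) (β : STy) : SimpleRen (upRen ρ) (β :: Ψ) (β :: Ψr)
  | 0, _, hi => hi
  | i + 1, α, hi => h i α hi

mutual
theorem SimpleSynth.ren {Ψ Ψr : List STy} {ρ : ℕ → ℕ} {R : Atm} {α : STy}
    (hρ : SimpleRen ρ Ψ Ψr) : SimpleSynth Ψ R α → SimpleSynth Ψr (R.ren ρ) α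
  | .const _ c α => .const _ c α
  | .var hi => .var (hρ _ _ hi)
  | .app hR hN => .app (hR.ren hρ) (hN.ren hρ)
theorem SimpleCheck.ren {Ψ Ψr : List STy} {ρ : ℕ → ℕ} {N : Nrm} {α : STy}
    (hρ : SimpleRen ρ Ψ Ψr) : SimpleCheck Ψ N α → SimpleCheck Ψr (N.ren ρ) α
  | .atom hR => .atom (hR.ren hρ)
  | .lam hN => .lam (hN.ren (hρ.up _))
end

theorem SimpleATy.ren {Ψ Ψr : List STy} {ρ : ℕ → ℕ} {P : ATy}
    (hρ : SimpleRen ρ Ψ Ψr) : SimpleATy Ψ P → SimpleATy Ψr (P.ren ρ)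
  | .const a => .const a
  | .app hP hN => .app (hP.ren hρ) (hN.ren hρ)

theorem SimpleTy.ren {Ψ Ψr : List STy} {ρ : ℕ → ℕ} {A : Ty}
    (hρ : SimpleRen ρ Ψ Ψr) : SimpleTy Ψ A → SimpleTy Ψr (A.ren ρ)
  | .atom hP => .atom (hP.ren hρ)
  | .pi (A := A) hA hB => .pi (hA.ren hρ) (hB.ren (A.erase_ren ρ ▸ hρ.up A.erase))

theorem SimpleTy.wk {Ψ : List STy} {A : Ty} (h : SimpleTy Ψ A) (β : STy) : SimpleTy (β :: Ψ) A.wk :=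
  h.ren fun _ _ hi => hi

mutual
theorem SimpleSynth.ren_eq_self {Ψ : List STy} {ρ : ℕ → ℕ} {R : Atm} {α : STy}
    (hρ : ∀ i < Ψ.length, ρ i = i) :
    SimpleSynth Ψ R α → R.ren ρ = R
  | .const _ _ _ => rfl
  | .var hi => congrArg Atm.var (hρ _ (List.getElem?_eq_some_iff.1 hi).1)
  | .app hR hN => congrArg₂ Atm.app (hR.ren_eq_self hρ) (hN.ren_eq_self hρ)
theorem SimpleCheck.ren_eq_self {Ψ : List STy} {ρ : ℕ → ℕ} {N : Nrm} {α : STy}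
    (hρ : ∀ i < Ψ.length, ρ i = i) :
    SimpleCheck Ψ N α → N.ren ρ = N
  | .atom hR => congrArg Nrm.atom (hR.ren_eq_self hρ)
  | .lam hN => congrArg Nrm.lam (hN.ren_eq_self (Ψ := _ :: _) (upRen_eq_self hρ))
end

theorem SimpleATy.ren_eq_self {Ψ : List STy} {ρ : ℕ → ℕ} {P : ATy}
    (hρ : ∀ i < Ψ.length, ρ i = i) : SimpleATy Ψ P → P.ren ρ = P
  | .const _ => rfl
  | .app hP hN => congrArg₂ ATy.app (hP.ren_eq_self hρ) (hN.ren_eq_self hρ)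

theorem SimpleTy.ren_eq_self {Ψ : List STy} {ρ : ℕ → ℕ} {A : Ty}
    (hρ : ∀ i < Ψ.length, ρ i = i) : SimpleTy Ψ A → A.ren ρ = A
  | .atom hP => congrArg Ty.atom (hP.ren_eq_self hρ)
  | .pi hA hB =>
      congrArg₂ Ty.pi (hA.ren_eq_self hρ) (hB.ren_eq_self (Ψ := _ :: _) (upRen_eq_self hρ))

/-! ### The identity property of hereditary substitution -/

/- `skip (k + 1)` inserts a variable `y` right after the variable `x` with index `k`. Once `x` has
been substituted, `y` has index `k`, so `[η_α(y)/x] N = N[y/x]` reads as in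
`SimpleCheck.hsubst_expand_var`. -/

mutual
theorem SimpleSynth.hsubst_expand_var {Ψ : List STy} {k : ℕ} {R : Atm} {α β : STy}
    (hk : Ψ[k]? = some α) :
    SimpleSynth Ψ R β →
      HSubstRR (expand α (.var k)) k α (R.ren (skip (k + 1))) R ∨
      HSubstRN (expand α (.var k)) k α (R.ren (skip (k + 1))) (expand β R) β ∧
        sizeOf β ≤ sizeOf α
  | .const _ c _ => .inl (.const _ _ _ c)
  | .var (i := i) hi => by
      rcases lt_trichotomy i k with h | rfl | h
      · rw [Atm.ren, skip_of_lt (h.trans k.lt_succ_self)]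
        exact .inl (.varLt _ _ _ _ h)
      · obtain rfl : α = β := Option.some.inj (hk.symm.trans hi)
        rw [Atm.ren, skip_of_lt i.lt_succ_self]
        exact .inr ⟨.var _ _ _, le_rfl⟩
      · rw [Atm.ren, skip_of_le h]
        exact .inl (.varGt _ _ _ _ h.le)
  | .app (R := R) (N := N) (α := γ) hR hN => by
      have hN' := hN.hsubst_expand_var hk
      rcases hR.hsubst_expand_var hk with hR' | ⟨hR', hle⟩
      · exact .inl (.app hR' hN')
      · rw [STy.arr.sizeOf_spec] at hle
        have _ : sizeOf γ < sizeOf α := by omega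
        have hredex : HSubstN N 0 γ (expand γ (.var 0)) N := HSubstRN.expand (.var _ _ _) hN
        exact .inr ⟨.beta hR' hN' (HSubstRR.expand (.app (.wk _ _ R) hredex) β), by omega⟩
termination_by (sizeOf α, sizeOf R)
theorem SimpleCheck.hsubst_expand_var {Ψ : List STy} {k : ℕ} {N : Nrm} {α β : STy}
    (hk : Ψ[k]? = some α) :
    SimpleCheck Ψ N β → HSubstN (expand α (.var k)) k α (N.ren (skip (k + 1))) N
  | .atom hR => (hR.hsubst_expand_var hk).elim .atom fun h => .atomNorm h.1
  | .lam (N := N) (α := γ) hN => by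
      have hbody := hN.hsubst_expand_var (k := k + 1) hk
      rw [Nrm.ren, upRen_skip]
      exact .lam (by rwa [Nrm.wk, expand_ren])
termination_by (sizeOf α, sizeOf N)
theorem HSubstRN.expand {Ψ : List STy} {N₀ : Nrm} {k : ℕ} {α₀ β : STy} {R : Atm} {N : Nrm}
    (hR : HSubstRN N₀ k α₀ R N β) :
    SimpleCheck Ψ N β → HSubstN N₀ k α₀ (expand β R) N
  | .atom _ => .atomNorm hR
  | .lam (N := N) (α := β₁) (β := β₂) hN => by
      have harg : HSubstN N₀.wk (k + 1) α₀ (LFR.expand β₁ (.var 0)) (LFR.expand β₁ (.var 0)) :=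
        HSubstRR.expand (.varLt _ _ _ _ k.succ_pos) β₁
      have hbody : HSubstN (LFR.expand β₁ (.var 0)) 0 β₁ (N.ren (upRen Nat.succ)) N :=
        upRen_succ ▸ hN.hsubst_expand_var (k := 0) rfl
      exact .lam (HSubstRN.expand (.beta (hR.ren (.succ k)) harg hbody) hN)
termination_by (sizeOf β, 0)
end

theorem SimpleATy.hsubst_expand_var {Ψ : List STy} {k : ℕ} {α : STy} {P : ATy}
    (hk : Ψ[k]? = some α) :
    SimpleATy Ψ P → HSubstP (expand α (.var k)) k α (P.ren (skip (k + 1))) P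
  | .const a => .const _ _ _ a
  | .app hP hN => .app (hP.hsubst_expand_var hk) (hN.hsubst_expand_var hk)

theorem SimpleTy.hsubst_expand_var {Ψ : List STy} {k : ℕ} {α : STy} {A : Ty}
    (hk : Ψ[k]? = some α) (h : SimpleTy Ψ A) :
    HSubstA (expand α (.var k)) k α (A.ren (skip (k + 1))) A := by
  induction h generalizing k with
  | atom hP => exact .atom (hP.hsubst_expand_var hk)
  | pi _ _ ihA ihB =>
    refine .pi (ihA hk) ?_
    rw [upRen_skip, Nrm.wk, expand_ren]
    exact ihB hk

theorem SimpleTy.hsubst_expand_var_zero {Ψ : List STy} {α : STy} {A : Ty}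
    (h : SimpleTy (α :: Ψ) A) :
    HSubstA (expand α (.var 0)) 0 α (A.ren (upRen Nat.succ)) A :=
  upRen_succ ▸ h.hsubst_expand_var (k := 0) rfl

/-! ### Structural refinement -/

/-- Atomic sort and type families with the same arguments. -/
inductive SameArgs : ASrt → ATy → Prop
  | const (s : SConst) (a : TConst) : SameArgs (.const s) (.const a)
  | app {Q : ASrt} {P : ATy} (N : Nrm) : SameArgs Q P → SameArgs (.app Q N) (.app P N)

/-- The structural part of the judgment `S ⊏ A`, which ensures that every term in `S` occurs at the
corresponding place in `A`. Unlike the judgment itself, it is evidently stable under renaming. -/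
inductive Refines : Srt → Ty → Prop
  | atom {Q : ASrt} {P : ATy} : SameArgs Q P → Refines (.atom Q) (.atom P)
  | pi {S T : Srt} {A B : Ty} : Refines S A → Refines T B → Refines (.pi S A T) (.pi A B)
  | top (A : Ty) : Refines .top A
  | inter {S₁ S₂ : Srt} {A : Ty} : Refines S₁ A → Refines S₂ A → Refines (.inter S₁ S₂) A

theorem ClsSynth.sameArgs {Sg : Sig} {Γ : Ctx} {Q : ASrt} {P : ATy} {L : Cls} :
    ClsSynth Sg Γ Q P L → SameArgs Q P
  | .const _ => .const _ _
  | .app hQ _ _ => .app _ hQ.sameArgs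
  | .interLeft h => h.sameArgs
  | .interRight h => h.sameArgs

theorem SrtOk.refines {Sg : Sig} {Γ : Ctx} {S : Srt} {A : Ty} : SrtOk Sg Γ S A → Refines S A
  | .atom hQ => .atom hQ.sameArgs
  | .pi hS hT => .pi hS.refines hT.refines
  | .top _ _ => .top _
  | .inter h₁ h₂ => .inter h₁.refines h₂.refines

theorem SameArgs.ren {Q : ASrt} {P : ATy} (ρ : ℕ → ℕ) : SameArgs Q P → SameArgs (Q.ren ρ) (P.ren ρ)
  | .const s a => .const s a
  | .app _ h => .app _ (h.ren ρ)

theorem Refines.ren {S : Srt} {A : Ty} (ρ : ℕ → ℕ) : Refines S A → Refines (S.ren ρ) (A.ren ρ)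
  | .atom hQ => .atom (hQ.ren ρ)
  | .pi hS hT => .pi (hS.ren ρ) (hT.ren (upRen ρ))
  | .top _ => .top _
  | .inter h₁ h₂ => .inter (h₁.ren ρ) (h₂.ren ρ)

theorem SameArgs.ren_eq_self {ρ : ℕ → ℕ} {Q : ASrt} {P : ATy}
    (h : SameArgs Q P) (hP : P.ren ρ = P) : Q.ren ρ = Q := by
  induction h with
  | const => rfl
  | app N _ ih =>
    obtain ⟨hP, hN⟩ := ATy.app.inj hP
    exact congrArg₂ ASrt.app (ih hP) hN

theorem Refines.ren_eq_self {ρ : ℕ → ℕ} {S : Srt} {A : Ty}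
    (h : Refines S A) (hA : A.ren ρ = A) : S.ren ρ = S := by
  induction h generalizing ρ with
  | atom hQ => exact congrArg Srt.atom (hQ.ren_eq_self (Ty.atom.inj hA))
  | pi _ _ ihS ihT =>
    obtain ⟨hA, hB⟩ := Ty.pi.inj hA
    rw [Srt.ren, ihS hA, hA, ihT hB]
  | top => rfl
  | inter _ _ ih₁ ih₂ => exact congrArg₂ Srt.inter (ih₁ hA) (ih₂ hA)

theorem SameArgs.hsubst_ren {ρ : ℕ → ℕ} {N₀ : Nrm} {k : ℕ} {α₀ : STy} {Q : ASrt} {P : ATy}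
    (h : SameArgs Q P) (hP : HSubstP N₀ k α₀ (P.ren ρ) P) :
    HSubstQ N₀ k α₀ (Q.ren ρ) Q := by
  induction h with
  | const => exact .const _ _ _ _
  | app N _ ih =>
    obtain _ | ⟨hP, hN⟩ := hP
    exact .app (ih hP) hN

theorem Refines.hsubst_ren {ρ : ℕ → ℕ} {N₀ : Nrm} {k : ℕ} {α₀ : STy} {S : Srt} {A : Ty}
    (h : Refines S A) (hA : HSubstA N₀ k α₀ (A.ren ρ) A) :
    HSubstS N₀ k α₀ (S.ren ρ) S := by
  induction h generalizing N₀ k ρ with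
  | atom hQ =>
    obtain ⟨hP⟩ | _ := hA
    exact .atom (hQ.hsubst_ren hP)
  | pi _ _ ihS ihT =>
    obtain _ | ⟨hA, hB⟩ := hA
    exact .pi (ihS hA) hA (ihT hB)
  | top => exact .top _ _ _
  | inter _ _ ih₁ ih₂ => exact .inter (ih₁ hA) (ih₂ hA)

/-! ### Closed signatures and weakening -/

/-- LF signatures in which the types of term constants are closed. Closedness is expressed as
invariance under renaming, which is how weakening uses it. -/
def ClosedLFSig (Sg : LFSig) : Prop := ∀ c A, LFDecl.tm c A ∈ Sg → ∀ ρ, A.ren ρ = A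

/-- Signatures in which the sorts of term constants are closed, i.e. invariant under renaming. -/
def ClosedSig (Sg : Sig) : Prop := ∀ c S, Decl.tmSrt c S ∈ Sg → ∀ ρ, S.ren ρ = S

theorem tm_mem_eraseSig {Sg : Sig} {c : OConst} {A : Ty} :
    LFDecl.tm c A ∈ eraseSig Sg ↔ Decl.tm c A ∈ Sg := by
  rw [eraseSig, List.mem_filterMap]
  refine ⟨?_, fun h => ⟨_, h, rfl⟩⟩
  rintro ⟨_ | _ | _ | _ | _, hD, h⟩ <;> cases h
  exact hD

theorem SigOk.closedLFSig {Sg : Sig} (h : SigOk Sg) : ClosedLFSig (eraseSig Sg) := by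
  intro c A hc ρ
  rw [tm_mem_eraseSig] at hc
  induction h with
  | nil => cases hc
  | tm _ hA _ ih =>
    obtain _ | ⟨_, hc⟩ := hc
    · exact hA.simpleTy.ren_eq_self fun _ hi => absurd hi (Nat.not_lt_zero _)
    · exact ih hc
  | ty _ _ _ ih | sub _ _ _ ih | srt _ _ _ _ ih | tmSrt _ _ _ _ ih =>
    obtain _ | ⟨_, hc⟩ := hc
    exact ih hc

theorem SigOk.closedSig {Sg : Sig} (h : SigOk Sg) : ClosedSig Sg := by
  intro c S hc ρ
  induction h with
  | nil => cases hc
  | tmSrt hSg hA hS _ ih =>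
    obtain _ | ⟨_, hc⟩ := hc
    · exact hS.refines.ren_eq_self (hSg.closedLFSig _ _ (tm_mem_eraseSig.2 hA) ρ)
    · exact ih hc
  | ty _ _ _ ih | tm _ _ _ ih | sub _ _ _ ih | srt _ _ _ _ ih =>
    obtain _ | ⟨_, hc⟩ := hc
    exact ih hc

/-- Well-typed renamings between LF contexts. -/
def LFRen (ρ : ℕ → ℕ) (Γ Γr : LFCtx) : Prop :=
  ∀ i A, LFLookup Γ i A → LFLookup Γr (ρ i) (A.ren ρ)

/-- Well-sorted renamings between LFR contexts. -/
def CtxRen (ρ : ℕ → ℕ) (Γ Γr : Ctx) : Prop :=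
  ∀ i S A, Lookup Γ i S A → Lookup Γr (ρ i) (S.ren ρ) (A.ren ρ)

theorem LFRen.up {Γ Γr : LFCtx} {ρ : ℕ → ℕ}
    (h : LFRen ρ Γ Γr) (B : Ty) : LFRen (upRen ρ) (B :: Γ) (B.ren ρ :: Γr)
  | _, _, .zero _ _ => Ty.ren_upRen_wk ρ B ▸ .zero _ _
  | _, _, .succ (A := A) _ hi => Ty.ren_upRen_wk ρ A ▸ .succ _ (h _ _ hi)

mutual
theorem LFSynth.ren {Sg : LFSig} {Γ Γr : LFCtx} {ρ : ℕ → ℕ} {R : Atm} {A : Ty}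
    (hSg : ClosedLFSig Sg) (hρ : LFRen ρ Γ Γr) :
    LFSynth Sg Γ R A → LFSynth Sg Γr (R.ren ρ) (A.ren ρ)
  | .const hc => .const (by rwa [hSg _ _ hc])
  | .var hi => .var (hρ _ _ hi)
  | .app (A := A) hR hN hB =>
      .app (hR.ren hSg hρ) (hN.ren hSg hρ) (A.erase_ren ρ ▸ hB.ren (.zero ρ))
theorem LFCheck.ren {Sg : LFSig} {Γ Γr : LFCtx} {ρ : ℕ → ℕ} {N : Nrm} {A : Ty}
    (hSg : ClosedLFSig Sg) (hρ : LFRen ρ Γ Γr) :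
    LFCheck Sg Γ N A → LFCheck Sg Γr (N.ren ρ) (A.ren ρ)
  | .atom hR => .atom (hR.ren hSg hρ)
  | .lam hN => .lam (hN.ren hSg (hρ.up _))
end

theorem LFSynth.wk {Sg : LFSig} {Γ : LFCtx} {R : Atm} {A : Ty}
    (hSg : ClosedLFSig Sg) (h : LFSynth Sg Γ R A) (B : Ty) :
    LFSynth Sg (B :: Γ) R.wk A.wk :=
  h.ren hSg fun _ _ hi => .succ B hi

theorem CtxRen.up {Γ Γr : Ctx} {ρ : ℕ → ℕ} (h : CtxRen ρ Γ Γr) (S : Srt) (A : Ty) :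
    CtxRen (upRen ρ) ((S, A) :: Γ) ((S.ren ρ, A.ren ρ) :: Γr)
  | _, _, _, .zero _ _ _ => Srt.ren_upRen_wk ρ S ▸ Ty.ren_upRen_wk ρ A ▸ .zero _ _ _
  | _, _, _, .succ (S := T) (A := B) _ hi =>
      Srt.ren_upRen_wk ρ T ▸ Ty.ren_upRen_wk ρ B ▸ .succ _ (h _ _ _ hi)

theorem SubStep.ren {Sg : Sig} {Q Qr : ASrt}
    (ρ : ℕ → ℕ) : SubStep Sg Q Qr → SubStep Sg (Q.ren ρ) (Qr.ren ρ)
  | .const hs => .const hs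
  | .app _ h => .app _ (h.ren ρ)

theorem Subsort.ren {Sg : Sig} {Q Qr : ASrt}
    (ρ : ℕ → ℕ) : Subsort Sg Q Qr → Subsort Sg (Q.ren ρ) (Qr.ren ρ)
  | .refl _ => .refl _
  | .step h hs => .step (h.ren ρ) (hs.ren ρ)

mutual
theorem Synth.ren {Sg : Sig} {Γ Γr : Ctx} {ρ : ℕ → ℕ} {R : Atm} {S : Srt}
    (hSg : ClosedSig Sg) (hρ : CtxRen ρ Γ Γr) :
    Synth Sg Γ R S → Synth Sg Γr (R.ren ρ) (S.ren ρ)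
  | .const hc => .const (by rwa [hSg _ _ hc])
  | .var hi => .var (hρ _ _ _ hi)
  | .app (A := A) hR hN hT =>
      .app (hR.ren hSg hρ) (hN.ren hSg hρ) (A.erase_ren ρ ▸ hT.ren (.zero ρ))
  | .interLeft h => .interLeft (h.ren hSg hρ)
  | .interRight h => .interRight (h.ren hSg hρ)
theorem Check.ren {Sg : Sig} {Γ Γr : Ctx} {ρ : ℕ → ℕ} {N : Nrm} {S : Srt}
    (hSg : ClosedSig Sg) (hρ : CtxRen ρ Γ Γr) :
    Check Sg Γ N S → Check Sg Γr (N.ren ρ) (S.ren ρ)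
  | .switch hR hQ => .switch (hR.ren hSg hρ) (hQ.ren ρ)
  | .lam hN => .lam (hN.ren hSg (hρ.up _ _))
  | .top _ _ => .top _ _
  | .inter h₁ h₂ => .inter (h₁.ren hSg hρ) (h₂.ren hSg hρ)
end

theorem Synth.wk {Sg : Sig} {Γ : Ctx} {R : Atm} {S : Srt}
    (hSg : ClosedSig Sg) (h : Synth Sg Γ R S) (D : Srt × Ty) :
    Synth Sg (D :: Γ) R.wk S.wk :=
  h.ren hSg fun _ _ _ hi => .succ D hi

/-! ### Expansion and identity -/

mutual
theorem LFSynth.check_expand {Sg : LFSig} {Γ : LFCtx} {R : Atm} {A : Ty} (hSg : ClosedLFSig Sg) :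
    SimpleTy (Γ.map Ty.erase) A → LFSynth Sg Γ R A → LFCheck Sg Γ (expand A.erase R) A
  | .atom (P := P) _, hR => by
      rw [Ty.erase, expand_erase]
      exact .atom hR
  | .pi (A := A) (B := B) hA hB, hR => by
      have hvar : LFCheck Sg (A :: Γ) (expand A.erase (.var 0)) A.wk :=
        .expand_var_zero hSg hA
      have hcod : HSubstA (expand A.erase (.var 0)) 0 A.wk.erase (B.ren (upRen Nat.succ)) B := by
        rw [A.erase_wk]
        exact hB.hsubst_expand_var_zero
      exact .lam (LFSynth.check_expand (Γ := A :: Γ) hSg hB (.app (hR.wk hSg A) hvar hcod))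
termination_by (sizeOf A.erase, 0)
decreasing_by all_goals grind [Ty.erase, STy.arr.sizeOf_spec]
theorem LFCheck.expand_var_zero {Sg : LFSig} {Γ : LFCtx} {A : Ty} (hSg : ClosedLFSig Sg)
    (hA : SimpleTy (Γ.map Ty.erase) A) :
    LFCheck Sg (A :: Γ) (expand A.erase (.var 0)) A.wk := by
  rw [← A.erase_wk]
  exact LFSynth.check_expand (Γ := A :: Γ) hSg (hA.wk A.erase) (.var (.zero Γ A))
termination_by (sizeOf A.erase, 1)
decreasing_by grind [Ty.erase_wk]
end

mutual
theorem Synth.check_expand {Sg : Sig} {Γ : Ctx} {R : Atm} {S : Srt} {A : Ty}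
    (hSg : ClosedSig Sg) (hA : SimpleTy ((eraseCtx Γ).map Ty.erase) A) :
    Refines S A → Synth Sg Γ R S → Check Sg Γ (expand A.erase R) S
  | .atom (P := P) _, hR => by
      rw [Ty.erase, expand_erase]
      exact .switch hR (.refl _)
  | .pi (S := S) (T := T) (A := A) hS hT, hR => by
      obtain _ | ⟨hA, hB⟩ := hA
      have hvar : Check Sg ((S, A) :: Γ) (expand A.erase (.var 0)) S.wk :=
        .expand_var_zero hSg hA hS
      have hcod : HSubstS (expand A.erase (.var 0)) 0 A.wk.erase (T.ren (upRen Nat.succ)) T := by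
        rw [A.erase_wk]
        exact hT.hsubst_ren hB.hsubst_expand_var_zero
      exact .lam (Synth.check_expand (Γ := (S, A) :: Γ) hSg hB hT
        (.app (hR.wk hSg (S, A)) hvar hcod))
  | .top _, _ => .top _ _
  | .inter h₁ h₂, hR =>
      .inter (Synth.check_expand hSg hA h₁ hR.interLeft)
        (Synth.check_expand hSg hA h₂ hR.interRight)
termination_by (sizeOf A.erase, 0, sizeOf S)
decreasing_by all_goals grind [Ty.erase, STy.arr.sizeOf_spec, Srt.inter.sizeOf_spec]
theorem Check.expand_var_zero {Sg : Sig} {Γ : Ctx} {S : Srt} {A : Ty}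
    (hSg : ClosedSig Sg) (hA : SimpleTy ((eraseCtx Γ).map Ty.erase) A) (hS : Refines S A) :
    Check Sg ((S, A) :: Γ) (expand A.erase (.var 0)) S.wk := by
  rw [← A.erase_wk]
  exact Synth.check_expand (Γ := (S, A) :: Γ) hSg (hA.wk A.erase) (hS.ren Nat.succ)
    (.var (.zero Γ S A))
termination_by (sizeOf A.erase, 1, 0)
decreasing_by grind [Ty.erase_wk]
end

end LFR

theorem mainTheorem3_general {Sg : Sig} (hLF : ClosedLFSig (eraseSig Sg)) (hSg : ClosedSig Sg)
    {Γ : Ctx} {S : Srt} {A : Ty} (hA : SimpleTy ((eraseCtx Γ).map Ty.erase) A)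
    (hS : Refines S A) :
    (∀ R, Synth Sg Γ R S → Check Sg Γ (expand A.erase R) S ∧
      (LFSynth (eraseSig Sg) (eraseCtx Γ) R A →
        LFCheck (eraseSig Sg) (eraseCtx Γ) (expand A.erase R) A)) ∧
    (Check Sg ((S, A) :: Γ) (expand A.erase (.var 0)) S.wk ∧
      LFCheck (eraseSig Sg) (eraseCtx ((S, A) :: Γ)) (expand A.erase (.var 0)) A.wk) :=
  ⟨fun _ hR => ⟨hR.check_expand hSg hA hS, LFSynth.check_expand hLF hA⟩,
    .expand_var_zero hSg hA hS, .expand_var_zero hLF hA⟩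

theorem mainTheorem3 (Sg : Sig) (hSg : SigOk Sg) :
    -- Expansion
    (∀ (Γ : Ctx) (S : Srt) (A : Ty) (R : Atm),
      CtxOk Sg Γ → LFCtxOk (eraseSig Sg) (eraseCtx Γ) →
      LFTyOk (eraseSig Sg) (eraseCtx Γ) A → SrtOk Sg Γ S A →
      Synth Sg Γ R S →
        Check Sg Γ (expand A.erase R) S ∧
        (LFSynth (eraseSig Sg) (eraseCtx Γ) R A →
          LFCheck (eraseSig Sg) (eraseCtx Γ) (expand A.erase R) A)) ∧
    -- Identity
    (∀ (Γ : Ctx) (S : Srt) (A : Ty),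
      CtxOk Sg Γ → LFCtxOk (eraseSig Sg) (eraseCtx Γ) →
      LFTyOk (eraseSig Sg) (eraseCtx Γ) A → SrtOk Sg Γ S A →
        Check Sg ((S, A) :: Γ) (expand A.erase (.var 0)) S.wk ∧
        LFCheck (eraseSig Sg) (eraseCtx ((S, A) :: Γ)) (expand A.erase (.var 0)) A.wk) := by
  have general {Γ : Ctx} {S : Srt} {A : Ty} (hA : LFTyOk (eraseSig Sg) (eraseCtx Γ) A)
      (hS : SrtOk Sg Γ S A) :=
    mainTheorem3_general hSg.closedLFSig hSg.closedSig hA.simpleTy hS.refines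
  exact ⟨fun _ _ _ R _ _ hA hS => (general hA hS).1 R, fun _ _ _ _ _ hA hS => (general hA hS).2⟩
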